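/- All graphs are finite and simple. A polyhedron is a $3$-connected plane graph. A separating set (vertex cutset) of a graph $G$ is a set $S\subset V(G)$ such that $G-S$ has more components than $G$; a $3$-cut is a separating set with exactly three elements. Let $c(H)$ denote the number of components of a graph $H$. The scattering number of $G$ is $s(G)=\max\{c(G-X)-|X| : X\subset V(G),\ c(G-X)\ge 2\}$ (with $\max\emptyset=-\infty$), and $G$ is called $1$-tough if $s(G)\le 0$. Corollary. Let $d\ge 0$ be an integer and let $G$ be a polyhedron with at most $d$ $3$-cuts. Then for every separating set $S$ of $G$, except when $d=1$ and $|S|=3$, $$c(G-S)\le |S|-2+\left\lfloor \tfrac d2\right\rfloor .$$ If $G$ has at most five $3$-cuts, then $c(G-S)\le |S|$ for every separating set $S$, so $G$ is $1$-tough. If $G$ has at most seven $3$-cuts, then $c(G-S)\le |S|+1$ for every separating set $S$, so the scattering number of $G$ is at most $1$. -/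

import Mathlib

namespace SimpleGraph

variable {V : Type*}

/-- `c(G - S)`: the number of connected components of the subgraph induced by the vertices
outside `S`. -/
noncomputable def numComponentsAfter (G : SimpleGraph V) (S : Finset V) : ℕ :=
  Nat.card (G.induce ((S : Set V)ᶜ)).ConnectedComponent

/-- A vertex cutset (splitting set, separating set): `G - S` has more components than `G`. -/
def IsVertexCutset (G : SimpleGraph V) (S : Finset V) : Prop :=
  Nat.card G.ConnectedComponent < G.numComponentsAfter S

/-- The number of `3`-cuts, that is, of vertex cutsets with exactly three elements. -/
noncomputable def numThreeCuts (G : SimpleGraph V) : ℕ :=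
  {S : Finset V | S.card = 3 ∧ G.IsVertexCutset S}.ncard

/-- `G` is `k`-vertex-connected: it has more than `k` vertices, and deleting fewer than `k`
vertices always leaves a connected graph. -/
def IsVertexConnected (G : SimpleGraph V) (k : ℕ) : Prop :=
  k < Nat.card V ∧ ∀ S : Finset V, S.card < k → (G.induce ((S : Set V)ᶜ)).Connected

open Classical in
/-- The scattering number `max {c(G - X) - |X| : c(G - X) ≥ 2}`, where the maximum over the empty
set (which occurs exactly for complete graphs) is `⊥`, i.e. `-∞`. -/
noncomputable def scatteringNumber [Fintype V] (G : SimpleGraph V) : WithBot ℤ :=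
  (Finset.univ.filter fun X : Finset V => 2 ≤ G.numComponentsAfter X).sup
    fun X => (((G.numComponentsAfter X : ℤ) - (X.card : ℤ) : ℤ) : WithBot ℤ)

/-- A graph is `1`-tough if its scattering number is at most `0`. -/
def IsOneTough [Fintype V] (G : SimpleGraph V) : Prop :=
  G.scatteringNumber ≤ 0

/-- A rotation system of `G`, that is, a combinatorial description of a drawing of `G` on an
oriented closed surface: a permutation `next` of the darts (oriented edges) which at every vertex
arranges the darts leaving that vertex in a single cyclic order. -/
structure RotationSystem (G : SimpleGraph V) where
  next : Equiv.Perm G.Dart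
  fst_next : ∀ a : G.Dart, (next a).fst = a.fst
  sameCycle_next : ∀ a b : G.Dart, a.fst = b.fst → next.SameCycle a b

namespace RotationSystem

variable {G : SimpleGraph V}

/-- Walking along the boundary of a face: after traversing the dart `a`, continue with the dart
that follows the reversal of `a` in the cyclic order at the end vertex of `a`. -/
def facePerm (R : G.RotationSystem) : Equiv.Perm G.Dart :=
  (Function.Involutive.toPerm _ (Dart.symm_involutive (G := G))).trans R.next

/-- The faces of the drawing, given by their boundary walks: the cycles (orbits) of `facePerm`. -/
def Face (R : G.RotationSystem) : Type _ :=
  Quotient (Equiv.Perm.SameCycle.setoid R.facePerm)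

/-- The Euler characteristic of the surface is `2`, i.e. the surface is the sphere. (For this
reading `G` has to be finite and connected with at least one edge, which is the case for every
`3`-connected finite graph.) -/
def IsPlane (R : G.RotationSystem) : Prop :=
  (Nat.card V : ℤ) - (Nat.card G.edgeSet : ℤ) + (Nat.card R.Face : ℤ) = 2

end RotationSystem

/-- A polyhedron: a `3`-connected plane graph. It consists of a `3`-connected graph on the vertex
type `V` together with a combinatorial embedding of it into the sphere. -/
structure Polyhedron (V : Type*) where
  graph : SimpleGraph V
  threeConnected : graph.IsVertexConnected 3
  rotation : graph.RotationSystem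
  isPlane : rotation.IsPlane

end SimpleGraph

/-! Let `c ≥ 2` be the number of components of `G - S`. Contract each component to a point and keep
one edge for each vertex of `S` attached to it. The resulting bipartite simple graph is planar, so
it has at most `2(|S| + c) - 4` edges. By 3-connectedness each component has at least three
attachments. If `|S| > 3`, the components with exactly three attachments give distinct 3-cuts, so
there are at least `4c - d` edges. Comparing, `2c + 4 ≤ 2|S| + d`. The case `|S| = 3` follows from
`c ≤ 2`.

The edge bound `card_bipartite_minor_le` is proved without drawing the minor. Keep a forest spanning
the contracted pieces and one edge per bipartite adjacency. Deleting the other edges merges faces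
into classes, whose number Euler's formula bounds from below. The edges across which the indicator
of a class changes meet every edge cut evenly. If there is more than one class, these edges cannot
all lie in the forest, and at least four of them are bipartite. Each edge has only two sides, which
bounds the number of classes from above. -/

open Finset

namespace SimpleGraph

variable {V : Type*} {G : SimpleGraph V}

/-! ### Labellings of the faces modulo 2 -/

namespace RotationSystem

variable (R : G.RotationSystem)

/-- The face that contains the dart `a` in its boundary walk. -/
def side (a : G.Dart) : R.Face := Quotient.mk (Equiv.Perm.SameCycle.setoid R.facePerm) a

theorem side_surjective : Function.Surjective R.side := Quotient.mk_surjective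

theorem side_next (a : G.Dart) : R.side (R.next a) = R.side a.symm := by
  refine Quotient.sound (s := Equiv.Perm.SameCycle.setoid R.facePerm) ?_
  change R.facePerm.SameCycle _ _
  have h : R.next a = R.facePerm a.symm := by
    simp [facePerm, Function.Involutive.toPerm]
  rw [h, Equiv.Perm.sameCycle_apply_left]

/-- The change modulo `2` of a labelling of the faces across a dart. -/
def jump (χ : R.Face → ZMod 2) (a : G.Dart) : ZMod 2 := χ (R.side a) + χ (R.side a.symm)

theorem jump_symm (χ : R.Face → ZMod 2) (a : G.Dart) : R.jump χ a.symm = R.jump χ a := by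
  simp [jump, add_comm]

theorem jump_eq_zero_iff (χ : R.Face → ZMod 2) (a : G.Dart) :
    R.jump χ a = 0 ↔ χ (R.side a) = χ (R.side a.symm) := CharTwo.add_eq_zero

theorem jump_congr_edge (χ : R.Face → ZMod 2) {a b : G.Dart} (h : a.edge = b.edge) :
    R.jump χ a = R.jump χ b := by
  rcases (dart_edge_eq_iff a b).1 h with rfl | rfl
  · rfl
  · exact R.jump_symm χ b

-- `next` permutes the darts at `v` and carries the face behind `a.symm` to the face of the next
-- dart, so each corner at `v` is counted twice.
open Classical in
theorem sum_jump_fst_eq [Fintype V] (χ : R.Face → ZMod 2) (v : V) :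
    ∑ a : G.Dart with a.fst = v, R.jump χ a = 0 := by
  have h : ∑ a : G.Dart with a.fst = v, χ (R.side a.symm) =
      ∑ a : G.Dart with a.fst = v, χ (R.side a) := by
    refine Finset.sum_equiv R.next (fun a => ?_) (fun a _ => ?_)
    · simp [R.fst_next]
    · rw [R.side_next]
  simp only [jump, Finset.sum_add_distrib, h, CharTwo.add_self_eq_zero]

-- Add the vertex identities over `U`: darts with both ends in `U` cancel against their reversals.
open Classical in
theorem sum_jump_boundary [Fintype V] (χ : R.Face → ZMod 2) (U : Set V) :
    ∑ a : G.Dart with a.fst ∈ U ∧ a.snd ∉ U, R.jump χ a = 0 := by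
  have h1 : ∑ a : G.Dart with a.fst ∈ U, R.jump χ a = 0 := by
    rw [← Finset.sum_fiberwise_of_maps_to (t := Finset.univ.filter (· ∈ U))
      (g := fun a : G.Dart => a.fst) (fun a ha => by simpa using ha)]
    refine Finset.sum_eq_zero fun v hv => ?_
    rw [Finset.filter_filter, ← R.sum_jump_fst_eq χ v]
    refine Finset.sum_congr (Finset.filter_congr fun a _ => ?_) fun _ _ => rfl
    simp only [Finset.mem_filter, Finset.mem_univ, true_and] at hv
    exact ⟨fun h => h.2, fun h => ⟨h ▸ hv, h⟩⟩
  have h2 : ∑ a : G.Dart with a.fst ∈ U ∧ a.snd ∈ U, R.jump χ a = 0 := by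
    refine Finset.sum_involution (fun a _ => a.symm) (fun a _ => ?_) (fun a _ _ => ?_)
      (fun a ha => ?_) (fun a _ => ?_)
    · rw [jump_symm, CharTwo.add_self_eq_zero]
    · exact a.symm_ne
    · simpa [and_comm] using ha
    · exact a.symm_symm
  rw [← Finset.sum_filter_add_sum_filter_not _ (fun a : G.Dart => a.snd ∈ U),
    Finset.filter_filter, Finset.filter_filter, h2, zero_add] at h1
  exact h1

/-- The edges across which a labelling of the faces changes do not meet an edge cut in exactly one
edge. -/
theorem exists_ne_jump_ne_zero [Finite V] (χ : R.Face → ZMod 2) (U : Set V) {a : G.Dart}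
    (hU : a.fst ∈ U) (hU' : a.snd ∉ U) (ha : R.jump χ a ≠ 0) :
    ∃ b : G.Dart, b ≠ a ∧ b.fst ∈ U ∧ b.snd ∉ U ∧ R.jump χ b ≠ 0 := by
  classical
  have := Fintype.ofFinite V
  by_contra! h
  refine ha ?_
  rw [← R.sum_jump_boundary χ U]
  refine (Finset.sum_eq_single_of_mem a (by simp [hU, hU']) fun b hb hne => ?_).symm
  simp only [Finset.mem_filter, Finset.mem_univ, true_and] at hb
  exact h b hne hb.1 hb.2

/-- With no jumps the label is constant around each vertex, because `next` has a single cycle there,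
and it is carried along walks from vertex to vertex. -/
theorem eq_of_jump_eq_zero (hG : G.Connected) (χ : R.Face → ZMod 2)
    (h : ∀ a, R.jump χ a = 0) (f g : R.Face) : χ f = χ g := by
  obtain ⟨a, rfl⟩ := R.side_surjective f
  obtain ⟨b, rfl⟩ := R.side_surjective g
  have hj : ∀ a, χ (R.side a.symm) = χ (R.side a) := fun a =>
    ((R.jump_eq_zero_iff χ a).1 (h a)).symm
  have hn : ∀ a b : G.Dart, a.fst = b.fst → χ (R.side a) = χ (R.side b) := by
    intro a b hab
    obtain ⟨k, rfl⟩ := R.sameCycle_next a b hab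
    have h1 : ∀ c, χ (R.side (R.next c)) = χ (R.side c) := fun c => by rw [side_next, hj]
    induction k with
    | zero => rfl
    | succ k ih =>
      rw [add_comm, zpow_add, zpow_one, Equiv.Perm.mul_apply, h1]
      refine ih ?_
      rw [add_comm, zpow_add, zpow_one, Equiv.Perm.mul_apply, R.fst_next] at hab
      exact hab
    | pred k ih =>
      have h2 : (R.next ^ (-(k : ℤ))) a = R.next ((R.next ^ (-(k : ℤ) - 1)) a) := by
        rw [← Equiv.Perm.mul_apply, ← zpow_one_add]
        congr 2
        ring
      rw [← h1 ((R.next ^ (-(k : ℤ) - 1)) a), ← h2]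
      refine ih ?_
      rw [h2, R.fst_next]
      exact hab
  obtain ⟨w⟩ := hG.preconnected a.fst b.fst
  have key : ∀ {u v : V} (w : G.Walk u v) (a b : G.Dart), a.fst = u → b.fst = v →
      χ (R.side a) = χ (R.side b) := by
    intro u v w
    induction w with
    | nil => exact fun a b ha hb => hn a b (ha.trans hb.symm)
    | @cons u x v hux p ih =>
      intro a b ha hb
      let c : G.Dart := ⟨(u, x), hux⟩
      rw [hn a c ha, ← hj c]
      exact ih c.symm b rfl hb
  exact key w a b rfl rfl

end RotationSystem

/-! ### Auxiliary facts on quotients and distances -/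

/-- Identifying `k` pairs of points decreases the number of points by at most `k`. -/
theorem card_le_card_quot_add {α ι : Type*} [Finite α] [Finite ι] (u v : ι → α) :
    Nat.card α ≤ Nat.card (Quot fun x y => ∃ i, u i = x ∧ v i = y) + Nat.card ι := by
  classical
  have := Fintype.ofFinite α
  have := Fintype.ofFinite ι
  set r : α → α → Prop := fun x y => ∃ i, u i = x ∧ v i = y with hr
  have := Fintype.ofFinite (Quot r)
  let L : (α → ZMod 2) →ₗ[ZMod 2] (ι → ZMod 2) :=
    { toFun := fun g i => g (u i) - g (v i)
      map_add' := fun g h => by ext i; simp; ring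
      map_smul' := fun c g => by ext i; simp; ring }
  let Q : (Quot r → ZMod 2) →ₗ[ZMod 2] (α → ZMod 2) := LinearMap.funLeft _ _ (Quot.mk r)
  -- Functions agreeing on every identified pair descend to the quotient; the bound is then
  -- rank-nullity for `L`.
  have h1 : LinearMap.ker L ≤ LinearMap.range Q := by
    intro g hg
    refine ⟨Quot.lift g ?_, ?_⟩
    · rintro x y ⟨i, rfl, rfl⟩
      exact sub_eq_zero.1 (congrFun (LinearMap.mem_ker.1 hg) i)
    · ext x
      rfl
  have h2 := Submodule.finrank_mono h1
  have h3 := LinearMap.finrank_range_le Q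
  have h4 := LinearMap.finrank_range_add_finrank_ker L
  have h5 := Submodule.finrank_le (LinearMap.range L)
  simp only [Module.finrank_fintype_fun_eq_card] at h3 h4 h5
  simp only [Nat.card_eq_fintype_card]
  omega

theorem Reachable.exists_adj_dist_lt {x y : V} (h : G.Reachable x y) (hne : x ≠ y) :
    ∃ z, G.Adj x z ∧ G.dist z y < G.dist x y := by
  obtain ⟨w, hw⟩ := h.exists_walk_length_eq_dist
  cases w with
  | nil => exact absurd rfl hne
  | @cons _ z _ hz p =>
    refine ⟨z, hz, ?_⟩
    rw [← hw, Walk.length_cons]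
    exact Nat.lt_succ_of_le (dist_le p)

/-! ### The edge bound for bipartite minors -/

namespace RotationSystem

variable (R : G.RotationSystem) {T I J : Type*} {π : V → I ⊕ J}

/-- If the labelling of the faces changes only across the edges of a rooted forest, given by
darts towards the roots, then it changes nowhere. -/
theorem jump_eq_zero_of_forest [Finite V] (χ : R.Face → ZMod 2) (ι : T → V) (t : T → G.Dart)
    (ht : ∀ x, (t x).fst = ι x) (depth : V → ℕ)
    (hdepth : ∀ x, depth (t x).snd < depth (t x).fst)
    (hinj : Function.Injective ι)
    (hχ : ∀ a, R.jump χ a ≠ 0 → ∃ x, a.edge = (t x).edge) (a : G.Dart) : R.jump χ a = 0 := by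
  classical
  have := Finite.of_injective ι hinj
  have hT : ∀ x, R.jump χ (t x) = 0 := by
    by_contra! hne
    -- At a deepest jumping forest dart, evenness at its start vertex forces a second jumping edge
    -- there, which would come from a deeper child.
    obtain ⟨x, hx, hmax⟩ := Set.exists_max_image {x | R.jump χ (t x) ≠ 0}
      (fun x => depth (t x).fst) (Set.toFinite _) hne
    obtain ⟨b, hba, hb1, -, hb⟩ := R.exists_ne_jump_ne_zero χ {(t x).fst} (a := t x) rfl
      (fun h => (t x).adj.ne' h) hx
    obtain ⟨y, hy⟩ := hχ b hb
    have hyne : R.jump χ (t y) ≠ 0 := by rwa [← R.jump_congr_edge χ hy]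
    rcases (dart_edge_eq_iff b (t y)).1 hy with rfl | rfl
    · exact hba (congrArg t (hinj (by rw [← ht, ← ht]; exact hb1)))
    · have h1 := hdepth y
      have h2 := hmax y hyne
      have h3 : (t y).snd = (t x).fst := hb1
      rw [h3] at h1
      omega
  by_contra h
  obtain ⟨x, hx⟩ := hχ a h
  exact h (by rw [R.jump_congr_edge χ hx, hT])

/-- Labels changing only inside the fibres of `π` and across the edges of a bipartite simple graph
between fibres change across at least four of the latter edges, if across any. -/
theorem four_le_card_jump [Finite V] (χ : R.Face → ZMod 2) (M : Finset (I × J))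
    (m : M → G.Dart) (h1 : ∀ p, π (m p).fst = .inl p.1.1) (h2 : ∀ p, π (m p).snd = .inr p.1.2)
    (hχ : ∀ a, R.jump χ a ≠ 0 → π a.fst ≠ π a.snd → ∃ p, a.edge = (m p).edge)
    {p : M} (hp : R.jump χ (m p) ≠ 0) [DecidablePred fun p => R.jump χ (m p) ≠ 0] :
    4 ≤ #{p | R.jump χ (m p) ≠ 0} := by
  classical
  have hl : ∀ p : M, R.jump χ (m p) ≠ 0 →
      ∃ q : M, R.jump χ (m q) ≠ 0 ∧ q.1.1 = p.1.1 ∧ q.1.2 ≠ p.1.2 := by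
    intro p hp
    obtain ⟨b, hb, hb1, hb2, hb3⟩ := R.exists_ne_jump_ne_zero χ {x | π x = .inl p.1.1}
      (h1 p) (by simp [h2]) hp
    simp only [Set.mem_ofPred_eq] at hb1 hb2
    obtain ⟨q, hq⟩ := hχ b hb3 (fun h => hb2 (h ▸ hb1))
    have hq0 : R.jump χ (m q) ≠ 0 := by rwa [← R.jump_congr_edge χ hq]
    rcases (dart_edge_eq_iff b (m q)).1 hq with rfl | rfl
    · rw [h1, Sum.inl.injEq] at hb1
      exact ⟨q, hq0, hb1, fun h => hb (congrArg m (Subtype.ext (Prod.ext hb1 h)))⟩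
    · exact absurd ((h2 q).symm.trans hb1) (by simp)
  have hr : ∀ p : M, R.jump χ (m p) ≠ 0 →
      ∃ q : M, R.jump χ (m q) ≠ 0 ∧ q.1.2 = p.1.2 ∧ q.1.1 ≠ p.1.1 := by
    intro p hp
    obtain ⟨b, hb, hb1, hb2, hb3⟩ := R.exists_ne_jump_ne_zero χ {x | π x = .inr p.1.2}
      (a := (m p).symm) (h2 p) (by simp [h1]) (by rwa [jump_symm])
    simp only [Set.mem_ofPred_eq] at hb1 hb2
    obtain ⟨q, hq⟩ := hχ b hb3 (fun h => hb2 (h ▸ hb1))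
    have hq0 : R.jump χ (m q) ≠ 0 := by rwa [← R.jump_congr_edge χ hq]
    rcases (dart_edge_eq_iff b (m q)).1 hq with rfl | rfl
    · exact absurd ((h1 q).symm.trans hb1) (by simp)
    · have hb1' : π (m q).snd = .inr p.1.2 := hb1
      rw [h2, Sum.inr.injEq] at hb1'
      exact ⟨q, hq0, hb1',
        fun h => hb (congrArg (fun r => (m r).symm) (Subtype.ext (Prod.ext h hb1')))⟩
  -- View `M` as cells of a grid: `q` shares the row of `p`, `r` its column, and `s` shares the row
  -- of `r`.
  obtain ⟨q, hq, hq1, hq2⟩ := hl p hp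
  obtain ⟨r, hr0, hr1, hr2⟩ := hr p hp
  obtain ⟨s, hs, hs1, hs2⟩ := hl r hr0
  have hcard : #({p, q, r, s} : Finset M) = 4 := by
    rw [card_insert_of_notMem, card_insert_of_notMem, card_insert_of_notMem, card_singleton]
    all_goals
      simp only [mem_insert, mem_singleton, not_or]
      grind
  rw [← hcard]
  refine card_le_card fun x hx => ?_
  simp only [mem_insert, mem_singleton] at hx
  simp only [mem_filter, mem_univ, true_and]
  rcases hx with rfl | rfl | rfl | rfl <;> assumption

/-- After deleting the edges outside `K` the drawing has at least `|F| - |E \ K|` faces. -/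
theorem card_face_le [Finite V] (K : Set (Sym2 V)) :
    Nat.card R.Face ≤ Nat.card (Quot fun f g => ∃ a : G.Dart, a.edge ∉ K ∧
      R.side a = f ∧ R.side a.symm = g) + (G.edgeSet \ K).ncard := by
  classical
  have := Fintype.ofFinite V
  have : Finite R.Face := Finite.of_surjective _ R.side_surjective
  have hd : ∀ e : ↥(G.edgeSet \ K), ∃ a : G.Dart, a.edge = e.1 := by
    rintro ⟨e, he, -⟩
    induction e using Sym2.ind with
    | _ x y => exact ⟨⟨(x, y), he⟩, rfl⟩
  choose d hd using hd
  have h := card_le_card_quot_add (fun e => R.side (d e)) (fun e => R.side (d e).symm)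
  refine h.trans (Nat.add_le_add_right ?_ _)
  refine Nat.card_le_card_of_surjective (Quot.lift (Quot.mk _) ?_) ?_
  swap
  · intro q
    induction q using Quot.ind with
    | _ f => exact ⟨Quot.mk _ f, rfl⟩
  rintro _ _ ⟨a, ha, rfl, rfl⟩
  have he := hd ⟨a.edge, a.edge_mem, ha⟩
  set e : ↥(G.edgeSet \ K) := ⟨a.edge, a.edge_mem, ha⟩
  rcases (dart_edge_eq_iff _ _).1 he with h | h
  · exact Quot.sound ⟨e, by rw [h], by rw [h]⟩
  · exact (Quot.sound ⟨e, by rw [h], by rw [h, Dart.symm_symm]⟩).symm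

/-- A bipartite simple graph with parts `I` and `J` that is a spanning minor of a connected plane
graph has at most `2 (|I| + |J|) - 4` edges. -/
theorem card_bipartite_minor_le [Finite V] [Finite I] [Finite J] (hG : G.Connected)
    (hR : R.IsPlane) (hπ : Function.Surjective π) (F : SimpleGraph V) (hF : F ≤ G)
    (hFπ : ∀ x y, F.Adj x y → π x = π y) (hreach : ∀ x y, π x = π y → F.Reachable x y)
    (M : Finset (I × J))
    (hM : ∀ p ∈ M, ∃ x y, G.Adj x y ∧ π x = .inl p.1 ∧ π y = .inr p.2)
    (h3 : 3 ≤ Nat.card I + Nat.card J) :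
    #M + 4 ≤ 2 * (Nat.card I + Nat.card J) := by
  classical
  have := Fintype.ofFinite V
  have := Fintype.ofFinite I
  have := Fintype.ofFinite J
  have : Finite R.Face := Finite.of_surjective _ R.side_surjective
  choose root hroot using hπ
  have hroot_inj : Function.Injective root := fun a b h => by rw [← hroot a, h, hroot]
  let depth : V → ℕ := fun x => F.dist x (root (π x))
  let T := {x : V // x ∉ Set.range root}
  -- Parents one step closer to the root give a rooted spanning tree of each fibre.
  have hpar : ∀ x : T, ∃ z, F.Adj x z ∧ depth z < depth x := by
    rintro ⟨x, hx⟩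
    obtain ⟨z, hz, hlt⟩ := (hreach x (root (π x)) (hroot _).symm).exists_adj_dist_lt
      (fun h => hx ⟨_, h.symm⟩)
    exact ⟨z, hz, by simpa only [depth, ← hFπ x z hz] using hlt⟩
  choose par hpar hlt using hpar
  let t : T → G.Dart := fun x => ⟨(x.1, par x), hF (hpar x)⟩
  have hm : ∀ p : M, ∃ a : G.Dart, π a.fst = .inl p.1.1 ∧ π a.snd = .inr p.1.2 := by
    rintro ⟨p, hp⟩
    obtain ⟨x, y, hxy, hx, hy⟩ := hM p hp
    exact ⟨⟨(x, y), hxy⟩, hx, hy⟩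
  choose m hm1 hm2 using hm
  have htπ : ∀ (x : T) (a : G.Dart), a.edge = (t x).edge → π a.fst = π a.snd := by
    intro x a ha
    rcases (dart_edge_eq_iff _ _).1 ha with rfl | rfl
    · exact hFπ _ _ (hpar x)
    · exact (hFπ _ _ (hpar x)).symm
  have hmπ : ∀ p, π (m p).fst ≠ π (m p).snd := fun p => by simp [hm1, hm2]
  let k : T ⊕ M → Sym2 V := Sum.elim (fun x => (t x).edge) (fun p => (m p).edge)
  have hk : Function.Injective k := by
    refine Function.Injective.sumElim ?_ ?_ ?_
    · intro x y hxy
      rcases (dart_edge_eq_iff _ _).1 hxy with h | h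
      · exact Subtype.ext (congrArg (fun a : G.Dart => a.fst) h)
      · have h1 : x.1 = par y := congrArg (fun a : G.Dart => a.fst) h
        have h2 : par x = y.1 := congrArg (fun a : G.Dart => a.snd) h
        have h3 := hlt x
        have h4 := hlt y
        rw [h2, h1] at h3
        exact absurd h3 h4.asymm
    · intro p q hpq
      have h1 := hm1 p
      have h2 := hm2 p
      rcases (dart_edge_eq_iff _ _).1 hpq with h | h
      · rw [h, hm1, Sum.inl.injEq] at h1
        rw [h, hm2, Sum.inr.injEq] at h2
        exact Subtype.ext (Prod.ext h1.symm h2.symm)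
      · rw [h] at h1
        exact absurd ((hm2 q).symm.trans h1) (by simp)
    · intro x p h
      exact hmπ p (htπ x _ h.symm)
  set K : Set (Sym2 V) := Set.range k with hK
  have hKE : K ⊆ G.edgeSet := by
    rintro _ ⟨x | p, rfl⟩
    · exact (t x).edge_mem
    · exact (m p).edge_mem
  have hKcard : K.ncard = Nat.card T + #M := by
    rw [hK, Set.ncard_def, ← Set.ncard_def, ← Nat.card_coe_set_eq, Nat.card_range_of_injective hk,
      Nat.card_sum, Nat.card_eq_fintype_card (α := M), Fintype.card_coe]
  have hTcard : Nat.card T + (Nat.card I + Nat.card J) = Nat.card V := by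
    have h := Set.ncard_add_ncard_compl (Set.range root)
    rw [← Nat.card_coe_set_eq, Nat.card_range_of_injective hroot_inj, Nat.card_sum,
      ← Nat.card_coe_set_eq] at h
    have h' : Nat.card T = Nat.card ↥(Set.range root)ᶜ := rfl
    omega
  have hdiff := Set.ncard_sdiff_add_ncard_of_subset hKE (Set.toFinite _)
  have hface := R.card_face_le K
  set Φ := Quot fun f g => ∃ a : G.Dart, a.edge ∉ K ∧ R.side a = f ∧ R.side a.symm = g with hΦ
  have hEuler : (Nat.card V : ℤ) - (Nat.card G.edgeSet : ℤ) + (Nat.card R.Face : ℤ) = 2 := hR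
  rw [Nat.card_coe_set_eq] at hEuler
  have hclasses : #M + 2 ≤ Nat.card Φ + (Nat.card I + Nat.card J) := by omega
  -- The first alternative suffices because `|I| + |J| ≥ 3`.
  suffices hcount : Nat.card Φ ≤ 1 ∨ 4 * Nat.card Φ ≤ 2 * #M by omega
  have := Fintype.ofFinite Φ
  let cls : G.Dart → Φ := fun a => Quot.mk _ (R.side a)
  let χ : Φ → R.Face → ZMod 2 := fun φ f => if Quot.mk _ f = φ then 1 else 0
  have hχK : ∀ φ a, R.jump (χ φ) a ≠ 0 → a.edge ∈ K := by
    intro φ a h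
    by_contra ha
    refine h ((R.jump_eq_zero_iff _ _).2 ?_)
    have : cls a = cls a.symm := Quot.sound ⟨a, ha, rfl, rfl⟩
    simp only [χ]
    exact if_congr (by rw [show Quot.mk _ (R.side a) = Quot.mk _ (R.side a.symm) from this]) rfl rfl
  by_cases hall : ∃ φ, ∀ p, R.jump (χ φ) (m p) = 0
  · left
    obtain ⟨φ, hφ⟩ := hall
    have hzero : ∀ a, R.jump (χ φ) a = 0 := by
      refine R.jump_eq_zero_of_forest (χ φ) (fun x : T => x.1) t (fun _ => rfl) depth hlt
        Subtype.val_injective fun a ha => ?_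
      obtain ⟨x | p, hx⟩ := hχK φ a ha
      · exact ⟨x, hx.symm⟩
      · exact absurd (hφ p) (by rwa [R.jump_congr_edge _ (show (m p).edge = a.edge from hx)])
    have hconst := R.eq_of_jump_eq_zero hG (χ φ) hzero
    rw [Nat.card_eq_fintype_card, Fintype.card_le_one_iff_subsingleton]
    obtain ⟨f, hf⟩ := Quot.exists_rep φ
    have hone : ∀ ψ : Φ, ψ = φ := by
      intro ψ
      obtain ⟨g, rfl⟩ := Quot.exists_rep ψ
      have h := hconst g f
      by_contra hne
      simp [χ, hf, hne] at h
    exact ⟨fun a b => (hone a).trans (hone b).symm⟩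
  · right
    push Not at hall
    -- Count the two sides of each bipartite edge: `2 * #M` in all, at least four in each class.
    let inc : M × Bool → Φ := fun q => if q.2 then cls (m q.1) else cls (m q.1).symm
    have hfib : ∀ φ : Φ, 4 ≤ #{q : M × Bool | inc q = φ} := by
      intro φ
      obtain ⟨p, hp⟩ := hall φ
      have h4 := R.four_le_card_jump (π := π) (χ φ) M m hm1 hm2 (fun a ha hne => by
        obtain ⟨x | q, hx⟩ := hχK φ a ha
        · exact absurd (htπ x a hx.symm) hne
        · exact ⟨q, hx.symm⟩) hp
      refine h4.trans ?_
      have hsub : ({p | R.jump (χ φ) (m p) ≠ 0} : Finset M) ⊆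
          ({q : M × Bool | inc q = φ} : Finset (M × Bool)).image Prod.fst := by
        intro p hp
        simp only [mem_filter, mem_univ, true_and] at hp
        simp only [mem_image, mem_filter, mem_univ, true_and]
        by_cases h1 : cls (m p) = φ
        · exact ⟨(p, true), by simpa [inc] using h1, rfl⟩
        by_cases h2 : cls (m p).symm = φ
        · exact ⟨(p, false), by simpa [inc] using h2, rfl⟩
        refine absurd ?_ hp
        rw [jump_eq_zero_iff]
        simp only [χ]
        rw [if_neg h1, if_neg h2]
      exact (card_le_card hsub).trans card_image_le
    have h := Finset.card_nsmul_le_sum (univ : Finset Φ) (fun φ => #{q : M × Bool | inc q = φ}) 4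
      (fun φ _ => hfib φ)
    have hsum : #(univ : Finset (M × Bool)) = ∑ φ : Φ, #{q : M × Bool | inc q = φ} :=
      Finset.card_eq_sum_card_fiberwise fun _ _ => mem_coe.2 (mem_univ _)
    rw [← hsum] at h
    simp only [card_univ, Fintype.card_prod, Fintype.card_coe, Fintype.card_bool,
      smul_eq_mul] at h
    rw [Nat.card_eq_fintype_card]
    omega

end RotationSystem

/-! ### Components of `G - S` and their attachments -/

open Classical in
/-- The vertices of `S` that have a neighbour in the component `C` of `G - S`. -/
noncomputable def attachments (S : Finset V)
    (C : (G.induce ((S : Set V)ᶜ)).ConnectedComponent) : Finset V :=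
  {s ∈ S | ∃ x, (G.induce ((S : Set V)ᶜ)).connectedComponentMk x = C ∧ G.Adj s x}

section attachments

variable {S X : Finset V} {C C' : (G.induce ((S : Set V)ᶜ)).ConnectedComponent}

theorem attachments_subset : attachments S C ⊆ S := by
  classical
  exact filter_subset _ _

theorem mem_attachments {s : V} : s ∈ attachments S C ↔
    s ∈ S ∧ ∃ x, (G.induce ((S : Set V)ᶜ)).connectedComponentMk x = C ∧ G.Adj s x := by
  simp [attachments]

/-- A walk can leave `C` only through an attachment, and those are all deleted with `X`. -/
theorem mem_component_of_reachable (hX : attachments S C ⊆ X) {u v : ↥((X : Set V)ᶜ)}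
    (h : (G.induce ((X : Set V)ᶜ)).Reachable u v)
    (hu : ∃ hu, (G.induce ((S : Set V)ᶜ)).connectedComponentMk ⟨u.1, hu⟩ = C) :
    ∃ hv, (G.induce ((S : Set V)ᶜ)).connectedComponentMk ⟨v.1, hv⟩ = C := by
  obtain ⟨w⟩ := h
  induction w with
  | nil => exact hu
  | @cons u w v huw p ih =>
    refine ih ?_
    obtain ⟨hu, rfl⟩ := hu
    have huw' : G.Adj u.1 w.1 := huw
    have hw : w.1 ∈ (S : Set V)ᶜ := fun hw =>
      w.2 (hX (mem_attachments.2 ⟨hw, ⟨u.1, hu⟩, rfl, huw'.symm⟩))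
    refine ⟨hw, (ConnectedComponent.sound (Adj.reachable ?_)).symm⟩
    exact huw'

theorem exists_not_reachable_attachments (hne : C ≠ C') :
    ∃ u v, ¬ (G.induce ((attachments S C : Set V)ᶜ)).Reachable u v := by
  induction C using ConnectedComponent.ind with | _ x
  induction C' using ConnectedComponent.ind with | _ y
  refine ⟨⟨x.1, fun h => x.2 (attachments_subset h)⟩, ⟨y.1, fun h => y.2 (attachments_subset h)⟩,
    fun h => ?_⟩
  obtain ⟨_, hy⟩ := mem_component_of_reachable Subset.rfl h ⟨x.2, rfl⟩
  exact hne hy.symm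

theorem IsVertexConnected.connected {k : ℕ} (hG : G.IsVertexConnected k) (hk : 0 < k) :
    G.Connected := by
  have h := hG.2 ∅ (by simpa using hk)
  rw [Finset.coe_empty, Set.compl_empty] at h
  exact (induceUnivIso G).connected_iff.1 h

theorem IsVertexConnected.le_card_attachments {k : ℕ} (hG : G.IsVertexConnected k)
    (hne : C ≠ C') : k ≤ #(attachments S C) := by
  by_contra! h
  obtain ⟨u, v, huv⟩ := exists_not_reachable_attachments hne
  exact huv ((hG.2 _ h).preconnected u v)

theorem Connected.card_connectedComponent (hG : G.Connected) :
    Nat.card G.ConnectedComponent = 1 := by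
  have := hG.nonempty
  rw [Nat.card_eq_one_iff_unique]
  exact ⟨hG.preconnected.subsingleton_connectedComponent, inferInstance⟩

theorem isVertexCutset_iff [Finite V] (hG : G.Connected) :
    G.IsVertexCutset S ↔ 2 ≤ G.numComponentsAfter S := by
  rw [IsVertexCutset, hG.card_connectedComponent]
  rfl

theorem isVertexCutset_attachments [Finite V] (hG : G.Connected) (hne : C ≠ C') :
    G.IsVertexCutset (attachments S C) := by
  obtain ⟨u, v, huv⟩ := exists_not_reachable_attachments hne
  rw [isVertexCutset_iff hG, numComponentsAfter, ← Nat.lt_iff_add_one_le,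
    Finite.one_lt_card_iff_nontrivial]
  exact ⟨⟨_, _, fun h => huv (ConnectedComponent.exact h)⟩⟩

/-- Two components attached to the same vertices, and a further vertex of `S`. -/
theorem three_le_numComponentsAfter_attachments [Finite V] (hne : C ≠ C')
    (heq : attachments S C = attachments S C') (hlt : #(attachments S C) < #S) :
    3 ≤ G.numComponentsAfter (attachments S C) := by
  classical
  obtain ⟨s, hs, hs'⟩ := exists_mem_notMem_of_card_lt_card hlt
  obtain ⟨x, hx⟩ := C.exists_rep
  obtain ⟨y, hy⟩ := C'.exists_rep
  have key : ∀ (D : (G.induce ((S : Set V)ᶜ)).ConnectedComponent) (u v),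
      attachments S D ⊆ attachments S C → (∃ hu, connectedComponentMk _ ⟨u.1, hu⟩ = D) →
      (¬ ∃ hv, connectedComponentMk _ ⟨v.1, hv⟩ = D) →
      (G.induce ((attachments S C : Set V)ᶜ)).connectedComponentMk u ≠
        (G.induce ((attachments S C : Set V)ᶜ)).connectedComponentMk v := fun D u v hD hu hv h =>
    hv (mem_component_of_reachable hD (ConnectedComponent.exact h) hu)
  let x' : ↥((attachments S C : Set V)ᶜ) := ⟨x.1, fun h => x.2 (attachments_subset h)⟩
  let y' : ↥((attachments S C : Set V)ᶜ) := ⟨y.1, fun h => y.2 (attachments_subset h)⟩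
  let s' : ↥((attachments S C : Set V)ᶜ) := ⟨s, hs'⟩
  have h1 := key C x' y' Subset.rfl ⟨x.2, hx⟩ fun ⟨_, h⟩ => hne (h.symm.trans hy)
  have h2 := key C x' s' Subset.rfl ⟨x.2, hx⟩ fun ⟨h, _⟩ => h hs
  have h3 := key C' y' s' heq.ge ⟨y.2, hy⟩ fun ⟨h, _⟩ => h hs
  have := Fintype.ofFinite (G.induce ((attachments S C : Set V)ᶜ)).ConnectedComponent
  rw [numComponentsAfter, Nat.card_eq_fintype_card, ← Nat.lt_iff_add_one_le,
    Fintype.two_lt_card_iff]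
  exact ⟨_, _, _, h1, h2, h3⟩

end attachments

theorem RotationSystem.sum_card_attachments_le [Finite V] (R : G.RotationSystem)
    (hR : R.IsPlane) (hG : G.Connected) (S : Finset V)
    [Fintype (G.induce ((S : Set V)ᶜ)).ConnectedComponent]
    (h3 : 3 ≤ #S + G.numComponentsAfter S) :
    ∑ C : (G.induce ((S : Set V)ᶜ)).ConnectedComponent, #(attachments S C) + 4 ≤
      2 * (#S + G.numComponentsAfter S) := by
  classical
  -- The contraction: vertices of `S` stay separate and each component collapses to a point.
  let π : V → S ⊕ (G.induce ((S : Set V)ᶜ)).ConnectedComponent := fun v =>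
    if h : v ∈ S then .inl ⟨v, h⟩ else .inr ((G.induce ((S : Set V)ᶜ)).connectedComponentMk ⟨v, h⟩)
  have hπS : ∀ v (h : v ∈ S), π v = .inl ⟨v, h⟩ := fun v h => dif_pos h
  have hπC : ∀ v : ↥((S : Set V)ᶜ), π v = .inr ((G.induce ((S : Set V)ᶜ)).connectedComponentMk v) :=
    fun v => dif_neg v.2
  let M : Finset (S × (G.induce ((S : Set V)ᶜ)).ConnectedComponent) :=
    {p | p.1.1 ∈ attachments S p.2}
  have hMcard : #M = ∑ C : (G.induce ((S : Set V)ᶜ)).ConnectedComponent, #(attachments S C) := by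
    rw [Finset.card_eq_sum_card_fiberwise (f := Prod.snd) (t := univ)
      fun _ _ => mem_coe.2 (mem_univ _)]
    refine Finset.sum_congr rfl fun C _ => ?_
    refine Finset.card_bij (fun p _ => p.1.1) ?_ ?_ ?_
    · rintro ⟨s, D⟩ hp
      simp only [M, mem_filter, mem_univ, true_and] at hp
      obtain ⟨hp, rfl⟩ := hp
      exact hp
    · rintro ⟨s, D⟩ hp ⟨s', D'⟩ hp' h
      simp only [M, mem_filter, mem_univ, true_and] at hp hp'
      exact Prod.ext (Subtype.ext h) (hp.2.trans hp'.2.symm)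
    · intro s hs
      exact ⟨(⟨s, attachments_subset hs⟩, C), by simpa [M] using hs, rfl⟩
  have h := R.card_bipartite_minor_le (I := S) (J := (G.induce ((S : Set V)ᶜ)).ConnectedComponent)
    (π := π) hG hR ?_
    ((G.induce ((S : Set V)ᶜ)).map (Function.Embedding.subtype _)) ?_ ?_ ?_ M ?_ ?_
  · rw [hMcard, Nat.card_eq_fintype_card (α := S), Fintype.card_coe] at h
    exact h
  · rintro (s | C)
    · exact ⟨s, hπS s s.2⟩
    · obtain ⟨x, rfl⟩ := C.exists_rep
      exact ⟨x, hπC x⟩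
  · exact (map_le_iff_le_comap _ _ _).2 le_rfl
  · rintro _ _ ⟨-, x, y, hxy, rfl, rfl⟩
    exact (hπC x).trans ((congrArg _ (ConnectedComponent.sound hxy.reachable)).trans (hπC y).symm)
  · intro x y hxy
    by_cases hx : x ∈ S <;> by_cases hy : y ∈ S
    · rw [hπS x hx, hπS y hy, Sum.inl.injEq, Subtype.mk.injEq] at hxy
      rw [hxy]
    · rw [hπS x hx, hπC ⟨y, hy⟩] at hxy
      simp at hxy
    · rw [hπS y hy, hπC ⟨x, hx⟩] at hxy
      simp at hxy
    · rw [hπC ⟨y, hy⟩, hπC ⟨x, hx⟩, Sum.inr.injEq] at hxy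
      exact (ConnectedComponent.exact hxy).map (Embedding.map _ (G.induce ((S : Set V)ᶜ))).toHom
  · intro p hp
    obtain ⟨-, x, hx, hadj⟩ := mem_attachments.1 (mem_filter.1 hp).2
    exact ⟨p.1, x, hadj, hπS _ p.1.2, by rw [hπC, hx]⟩
  · rw [Nat.card_eq_fintype_card (α := S), Fintype.card_coe]
    exact h3

/-! ### Counting attachments in a polyhedron -/

namespace Polyhedron

theorem connected (P : Polyhedron V) : P.graph.Connected := P.threeConnected.connected three_pos

variable [Finite V] (P : Polyhedron V) {S : Finset V}

theorem three_le_card_attachments (h2 : 2 ≤ P.graph.numComponentsAfter S)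
    (C : (P.graph.induce ((S : Set V)ᶜ)).ConnectedComponent) : 3 ≤ #(attachments S C) := by
  have := Finite.one_lt_card_iff_nontrivial.1 h2
  obtain ⟨C', hC'⟩ := exists_ne C
  exact P.threeConnected.le_card_attachments hC'.symm

theorem three_le_card_of_two_le (h2 : 2 ≤ P.graph.numComponentsAfter S) : 3 ≤ #S := by
  have := Finite.one_lt_card_iff_nontrivial.1 h2
  obtain ⟨C, -⟩ := exists_pair_ne (P.graph.induce ((S : Set V)ᶜ)).ConnectedComponent
  exact (P.three_le_card_attachments h2 C).trans (card_le_card attachments_subset)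

/-- Three components would yield a `K_{3,3}` minor; numerically, `3c + 4 ≤ 2(3 + c)` fails for `c ≥
3`. -/
theorem numComponentsAfter_le_two (hS : #S = 3) : P.graph.numComponentsAfter S ≤ 2 := by
  by_contra! h
  have := Fintype.ofFinite (P.graph.induce ((S : Set V)ᶜ)).ConnectedComponent
  have h1 := P.rotation.sum_card_attachments_le P.isPlane P.connected S (by omega)
  have h2 := Finset.card_nsmul_le_sum univ (fun C => #(attachments S C)) 3
    fun C _ => P.three_le_card_attachments (by omega) C
  rw [card_univ, ← Nat.card_eq_fintype_card, smul_eq_mul] at h2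
  change P.graph.numComponentsAfter S * 3 ≤ _ at h2
  omega

/-- Two components with the same three attachments, together with a leftover vertex of `S`, would
give three components after deleting three vertices. -/
theorem attachments_injOn (hS : 3 < #S) :
    Set.InjOn (attachments (G := P.graph) S) {C | #(attachments S C) = 3} := by
  intro C hC C' _ heq
  by_contra hne
  have h := three_le_numComponentsAfter_attachments hne heq (hC.trans_lt hS)
  have h' := P.numComponentsAfter_le_two hC
  omega

theorem two_mul_numComponentsAfter_le (h2 : 2 ≤ P.graph.numComponentsAfter S) (hS : 3 < #S) :
    2 * P.graph.numComponentsAfter S + 4 ≤ 2 * #S + P.graph.numThreeCuts := by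
  classical
  have := Fintype.ofFinite (P.graph.induce ((S : Set V)ᶜ)).ConnectedComponent
  have hnt := Finite.one_lt_card_iff_nontrivial.1 h2
  have h1 := P.rotation.sum_card_attachments_le P.isPlane P.connected S (by omega)
  -- Crediting one extra unit to each component with exactly three attachments brings every term up
  -- to four.
  have h4 := Finset.card_nsmul_le_sum univ
    (fun C : (P.graph.induce ((S : Set V)ᶜ)).ConnectedComponent =>
      #(attachments S C) + if #(attachments S C) = 3 then 1 else 0) 4 fun C _ => by
        have := P.three_le_card_attachments h2 C
        split_ifs <;> omega
  rw [card_univ, ← Nat.card_eq_fintype_card, smul_eq_mul, sum_add_distrib, sum_boole] at h4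
  change P.graph.numComponentsAfter S * 4 ≤ _ at h4
  have hcuts : #{C : (P.graph.induce ((S : Set V)ᶜ)).ConnectedComponent | #(attachments S C) = 3} ≤
      P.graph.numThreeCuts := by
    rw [numThreeCuts, ← Set.ncard_coe_finset]
    refine Set.ncard_le_ncard_of_injOn (attachments S) (fun C hC => ?_) ?_ (Set.toFinite _)
    · obtain ⟨C', hC'⟩ := exists_ne C
      exact ⟨by simpa using hC, isVertexCutset_attachments P.connected hC'.symm⟩
    · simpa using P.attachments_injOn hS
  rw [Nat.cast_id] at h4
  omega

theorem numComponentsAfter_add_two_le {d : ℕ} (hd : P.graph.numThreeCuts ≤ d)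
    (h2 : 2 ≤ P.graph.numComponentsAfter S) (h : ¬ (d = 1 ∧ #S = 3)) :
    P.graph.numComponentsAfter S + 2 ≤ #S + d / 2 := by
  have := Fintype.ofFinite V
  rcases (P.three_le_card_of_two_le h2).eq_or_lt with hS | hS
  -- `S` is itself a 3-cut, so `d ≥ 1`; as `d = 1` is excluded, `d / 2 ≥ 1`, which is enough since
  -- `c ≤ 2`.
  · have hpos : 0 < P.graph.numThreeCuts :=
      (Set.ncard_pos (Set.toFinite _)).2 ⟨S, hS.symm, (isVertexCutset_iff P.connected).2 h2⟩
    have := P.numComponentsAfter_le_two hS.symm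
    omega
  · have := P.two_mul_numComponentsAfter_le h2 hS
    omega

end Polyhedron

theorem scatteringNumber_le_of_forall [Fintype V] {k : ℤ}
    (h : ∀ X : Finset V, 2 ≤ G.numComponentsAfter X → (G.numComponentsAfter X : ℤ) ≤ #X + k) :
    G.scatteringNumber ≤ (k : WithBot ℤ) := by
  refine Finset.sup_le fun X hX => WithBot.coe_le_coe.2 ?_
  have := h X (by simpa using hX)
  omega

end SimpleGraph

theorem mainTheorem5 {V : Type*} [Fintype V] (P : SimpleGraph.Polyhedron V) :
    (∀ d : ℕ, P.graph.numThreeCuts ≤ d →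
      ∀ S : Finset V, P.graph.IsVertexCutset S → ¬ (d = 1 ∧ S.card = 3) →
        (P.graph.numComponentsAfter S : ℤ) ≤ (S.card : ℤ) - 2 + ((d / 2 : ℕ) : ℤ)) ∧
    (P.graph.numThreeCuts ≤ 5 →
      (∀ S : Finset V, P.graph.IsVertexCutset S → P.graph.numComponentsAfter S ≤ S.card) ∧
      P.graph.IsOneTough) ∧
    (P.graph.numThreeCuts ≤ 7 →
      (∀ S : Finset V, P.graph.IsVertexCutset S → P.graph.numComponentsAfter S ≤ S.card + 1) ∧
      P.graph.scatteringNumber ≤ 1) := by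
  have key := fun (d : ℕ) (hd : P.graph.numThreeCuts ≤ d) (S : Finset V) =>
    P.numComponentsAfter_add_two_le (S := S) hd
  refine ⟨fun d hd S hS h => ?_, fun hd => ⟨fun S hS => ?_, ?_⟩, fun hd => ⟨fun S hS => ?_, ?_⟩⟩
  · have := key d hd S ((SimpleGraph.isVertexCutset_iff P.connected).1 hS) h
    omega
  · have := key 5 hd S ((SimpleGraph.isVertexCutset_iff P.connected).1 hS) (by omega)
    omega
  · refine SimpleGraph.scatteringNumber_le_of_forall (k := 0) fun X hX => ?_
    have := key 5 hd X hX (by omega)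
    omega
  · have := key 7 hd S ((SimpleGraph.isVertexCutset_iff P.connected).1 hS) (by omega)
    omega
  · refine SimpleGraph.scatteringNumber_le_of_forall (k := 1) fun X hX => ?_
    have := key 7 hd X hX (by omega)
    omega
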